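/- There is a universal constant $C>0$ with the following property. Let $d,k\ge 1$ be integers, let $p\ge 1$ be real, and let $\|\cdot\|$ be a norm on $\mathbb R^d$ that is sign-invariant (invariant under changing the sign of any coordinate) and normalized (each canonical basis vector has norm $1$). Put $\kappa(x,y)=\|x-y\|$, let $\mathcal B_d=\{x\in\mathbb R^d:\|x\|\le \tfrac12\}$ be the $\kappa$-ball of diameter $1$ centered at the origin, and for a nonempty finite set $F\subset\mathbb R^d$ let $\kappa(x,F)=\min_{f\in F}\kappa(x,f)$. Let $\mathbb P$ be a Borel probability distribution on $\mathbb R^d$ supported in $\mathcal B_d$, let $\varepsilon,\delta\in(0,1)$, and let $X_1,\dots,X_n$ be i.i.d. samples from $\mathbb P$, where $$ n\;\ge\; C\,\frac{k^2d^2}{\varepsilon^4}\,\max\Bigl\{1,\log\frac p\delta\Bigr\}. $$ For $F\subset\mathcal B_d$ with $|F|=k$ write $$\widehat{\mathrm{cost}}(F)=\frac1n\sum_{i=1}^n\kappa(X_i,F)^p,\qquad \mathrm{cost}(F)=\mathbb E_{x\sim\mathbb P}\,\kappa(x,F)^p .$$ Then, with probability at least $1-\delta$, simultaneously for all $F\subset\mathcal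 B_d$ with $|F|=k$, $$\bigl|\widehat{\mathrm{cost}}(F)-\mathrm{cost}(F)\bigr|\le\varepsilon .$$ -/

import Mathlib

open MeasureTheory ProbabilityTheory

noncomputable section

namespace Clustering

/-- `N` is a norm on `ℝ^d` that is sign-invariant (invariant under changing the sign of a
coordinate) and normalized (the canonical basis vectors have unit length). -/
structure IsSignInvariantNorm {d : ℕ} (N : Seminorm ℝ (Fin d → ℝ)) : Prop where
  definite : ∀ x, N x = 0 → x = 0
  sign_invariant : ∀ (x : Fin d → ℝ) (i : Fin d), N (Function.update x i (-x i)) = N x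
  normalized : ∀ i : Fin d, N (Pi.single i 1) = 1

/-- The metric `κ` induced by the norm. -/
def kappa {d : ℕ} (N : Seminorm ℝ (Fin d → ℝ)) (x y : Fin d → ℝ) : ℝ := N (x - y)

/-- The (closed) `κ`-ball `B_d` of diameter `1` centered at the origin. -/
def ball {d : ℕ} (N : Seminorm ℝ (Fin d → ℝ)) : Set (Fin d → ℝ) :=
  {x | kappa N x 0 ≤ 1 / 2}

/-- The family of all sets of `k` centers in `B_d`. -/
def centerSets {d : ℕ} (N : Seminorm ℝ (Fin d → ℝ)) (k : ℕ) : Set (Finset (Fin d → ℝ)) :=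
  {F | (F : Set (Fin d → ℝ)) ⊆ ball N ∧ F.card = k}

/-- `κ(x, F)`, the shortest distance from `x` to a point of the (nonempty) finite set `F`. -/
def kappaSet {d : ℕ} (N : Seminorm ℝ (Fin d → ℝ)) (x : Fin d → ℝ)
    (F : Finset (Fin d → ℝ)) : ℝ :=
  ⨅ f : {f : Fin d → ℝ // f ∈ F}, kappa N x f

/-- The statistical cost `𝔼_{x ∼ P} κ(x, F)^p`. -/
def cost {d : ℕ} (N : Seminorm ℝ (Fin d → ℝ)) (p : ℝ) (P : Measure (Fin d → ℝ))
    (F : Finset (Fin d → ℝ)) : ℝ :=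
  ∫ x, kappaSet N x F ^ p ∂P

/-- The empirical cost `(1/n) ∑ κ(x_i, F)^p` of the points `x_1, …, x_n`. -/
def empiricalCost {d n : ℕ} (N : Seminorm ℝ (Fin d → ℝ)) (p : ℝ) (x : Fin n → Fin d → ℝ)
    (F : Finset (Fin d → ℝ)) : ℝ :=
  (1 / (n : ℝ)) * ∑ i, kappaSet N (x i) F ^ p

end Clustering

end

/-! The proof discretizes the centers, then combines Hoeffding's inequality with a union bound. The
norm lies between the sup norm and the `ℓ¹` norm, so the ball sits in the cube `[-1/2, 1/2]^d`, and
each of its points is within `d / m` of a grid with `(m + 1) ^ d` points. Grid points may leave the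
ball, so distances are clipped at `1`: costs stay in `[0, 1]`, and moving every center by at most
`η` changes them by at most `p * η`. With `m` about `4pd/ε`, passing to the grid costs `ε/4` in the
empirical mean and `ε/4` in the expectation. The remaining `ε/2` is the deviation allowed on the
grid, controlled for all `(m + 1) ^ (d * k)` tuples at once by `card_mul_hoeffding_le`. -/

namespace Clustering

/-! ### Comparison of the norm with coordinates -/

section Norm

variable {d : ℕ} {N : Seminorm ℝ (Fin d → ℝ)}

lemma IsSignInvariantNorm.le_sum_abs (hN : IsSignInvariantNorm N) (x : Fin d → ℝ) :
    N x ≤ ∑ i, |x i| := by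
  have hx : x = ∑ i, x i • (Pi.single i (1 : ℝ) : Fin d → ℝ) := by
    ext j
    simp [Finset.sum_apply, Pi.single_apply]
  calc N x = N (∑ i, x i • (Pi.single i (1 : ℝ) : Fin d → ℝ)) := by rw [← hx]
    _ ≤ ∑ i, N (x i • (Pi.single i (1 : ℝ) : Fin d → ℝ)) :=
        Finset.le_sum_of_subadditive N (map_zero N).le (map_add_le_add N) _ _
    _ = ∑ i, |x i| := by simp [map_smul_eq_mul, hN.normalized]

/-- Subtracting from `x` its reflection in coordinate `i` leaves `2 * x i` times a basis vector.
This is where sign invariance enters. -/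
lemma IsSignInvariantNorm.abs_apply_le (hN : IsSignInvariantNorm N) (x : Fin d → ℝ) (i : Fin d) :
    |x i| ≤ N x := by
  have h : (2 * x i) • (Pi.single i (1 : ℝ) : Fin d → ℝ) = x - Function.update x i (-x i) := by
    ext j
    by_cases hj : j = i
    · subst hj; simp; ring
    · simp [hj]
  have h1 : N ((2 * x i) • (Pi.single i (1 : ℝ) : Fin d → ℝ)) = 2 * |x i| := by
    simp [map_smul_eq_mul, hN.normalized]
  have h2 := map_sub_le_add N x (Function.update x i (-x i))
  rw [← h, h1, hN.sign_invariant] at h2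
  linarith

lemma IsSignInvariantNorm.continuous (hN : IsSignInvariantNorm N) : Continuous N := by
  refine (LipschitzWith.of_dist_le_mul (K := (d : NNReal)) fun x y => ?_).continuous
  calc dist (N x) (N y) ≤ N (x - y) := abs_sub_map_le_sub N x y
    _ ≤ ∑ i, |(x - y) i| := hN.le_sum_abs _
    _ ≤ ∑ _i : Fin d, dist x y :=
        Finset.sum_le_sum fun i _ => by simpa [Real.dist_eq] using dist_le_pi_dist x y i
    _ = _ := by simp

lemma sub_le_one_of_mem_ball {x y : Fin d → ℝ} (hx : x ∈ ball N) (hy : y ∈ ball N) :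
    N (x - y) ≤ 1 := by
  have hx' : N x ≤ 1 / 2 := by simpa [ball, kappa] using hx
  have hy' : N y ≤ 1 / 2 := by simpa [ball, kappa] using hy
  linarith [map_sub_le_add N x y]

end Norm

/-! ### Discretization of the cube -/

section Grid

/-- A point of the grid of mesh `1 / m` in the cube `[-1/2, 1/2]^d`. -/
noncomputable def gridPoint {d m : ℕ} (t : Fin d → Fin (m + 1)) : Fin d → ℝ := fun i => (t i : ℝ) / m - 1 / 2

lemma exists_grid_coordinate {m : ℕ} (hm : 0 < m) {y : ℝ} (hy : |y| ≤ 1 / 2) :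
    ∃ t : Fin (m + 1), |y - ((t : ℝ) / m - 1 / 2)| ≤ 1 / m := by
  obtain ⟨h1, h2⟩ := abs_le.1 hy
  have hm' : (0 : ℝ) < m := Nat.cast_pos.2 hm
  have h0 : 0 ≤ m * (y + 1 / 2) := by apply mul_nonneg <;> linarith
  have hle : m * (y + 1 / 2) ≤ m := mul_le_of_le_one_right hm'.le (by linarith)
  -- Round down; `y = 1/2` lands on index `m`, hence `m + 1` values.
  refine ⟨⟨⌊m * (y + 1 / 2)⌋₊, Nat.lt_succ_of_le (Nat.floor_le_of_le hle)⟩, ?_⟩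
  have ha := Nat.floor_le h0
  have hb := (Nat.lt_floor_add_one (m * (y + 1 / 2))).le
  have : y - ((⌊m * (y + 1 / 2)⌋₊ : ℝ) / m - 1 / 2)
      = (m * (y + 1 / 2) - ⌊m * (y + 1 / 2)⌋₊) / m := by field_simp; ring
  simp only [this]
  rw [abs_of_nonneg (div_nonneg (by linarith) hm'.le)]
  gcongr
  linarith

lemma IsSignInvariantNorm.exists_gridPoint {d : ℕ} {N : Seminorm ℝ (Fin d → ℝ)}
    (hN : IsSignInvariantNorm N) {m : ℕ} (hm : 0 < m) {y : Fin d → ℝ} (hy : y ∈ ball N) :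
    ∃ t : Fin d → Fin (m + 1), N (y - gridPoint t) ≤ d / m := by
  have hy' : N y ≤ 1 / 2 := by simpa [ball, kappa] using hy
  choose t ht using fun i => exists_grid_coordinate hm ((hN.abs_apply_le y i).trans hy')
  refine ⟨t, (hN.le_sum_abs _).trans ?_⟩
  calc ∑ i, |(y - gridPoint t) i| ≤ ∑ _i : Fin d, (1 : ℝ) / m :=
        Finset.sum_le_sum fun i _ => ht i
    _ = d / m := by simp [div_eq_mul_inv]

end Grid

/-- Mean value inequality: the derivative `p * t ^ (p - 1)` is at most `p` on `[0, 1]`. -/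
lemma abs_rpow_sub_rpow_le {p a b : ℝ} (hp : 1 ≤ p) (ha : a ∈ Set.Icc (0 : ℝ) 1)
    (hb : b ∈ Set.Icc (0 : ℝ) 1) : |a ^ p - b ^ p| ≤ p * |a - b| := by
  refine Convex.norm_image_sub_le_of_norm_hasDerivWithin_le (f := fun t : ℝ => t ^ p)
    (fun t _ => (Real.hasDerivAt_rpow_const (Or.inr hp)).hasDerivWithinAt) (fun t ht => ?_)
    (convex_Icc 0 1) hb ha
  have h0 : 0 ≤ t ^ (p - 1) := Real.rpow_nonneg ht.1 _
  rw [Real.norm_eq_abs, abs_of_nonneg (by positivity)]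
  exact mul_le_of_le_one_right (by linarith) (Real.rpow_le_one ht.1 ht.2 (by linarith))

lemma abs_ciInf_sub_ciInf_le {ι : Type*} [Finite ι] [Nonempty ι] {a b : ι → ℝ} {η : ℝ}
    (h : ∀ i, |a i - b i| ≤ η) : |(⨅ i, a i) - ⨅ i, b i| ≤ η := by
  have key : ∀ {a b : ι → ℝ}, (∀ i, |a i - b i| ≤ η) → (⨅ i, a i) - η ≤ ⨅ i, b i := by
    intro a b h
    refine le_ciInf fun i => ?_
    have := ciInf_le (Set.finite_range a).bddBelow i
    linarith [(abs_le.1 (h i)).2]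
  have h1 := key h
  have h2 := key fun i => (abs_sub_comm (b i) (a i)).trans_le (h i)
  exact abs_le.2 ⟨by linarith, by linarith⟩

/-! ### Costs clipped at distance one -/

section ClippedCost

variable {d k : ℕ} {N : Seminorm ℝ (Fin d → ℝ)} {p : ℝ}

/-- The `p`-th power of the distance to a tuple of centers, the distance being clipped at `1`. -/
noncomputable def clippedCost (N : Seminorm ℝ (Fin d → ℝ)) (p : ℝ) (g : Fin k → Fin d → ℝ)
    (x : Fin d → ℝ) : ℝ :=
  (min 1 (⨅ j, N (x - g j))) ^ p

lemma clipped_mem_Icc (N : Seminorm ℝ (Fin d → ℝ)) (g : Fin k → Fin d → ℝ) (x : Fin d → ℝ) :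
    min 1 (⨅ j, N (x - g j)) ∈ Set.Icc (0 : ℝ) 1 :=
  ⟨le_min zero_le_one (Real.iInf_nonneg fun _ => apply_nonneg N _), min_le_left _ _⟩

lemma clippedCost_mem_Icc (hp : 1 ≤ p) (g : Fin k → Fin d → ℝ) (x : Fin d → ℝ) :
    clippedCost N p g x ∈ Set.Icc (0 : ℝ) 1 :=
  ⟨Real.rpow_nonneg (clipped_mem_Icc N g x).1 _,
    Real.rpow_le_one (clipped_mem_Icc N g x).1 (clipped_mem_Icc N g x).2 (by linarith)⟩

lemma IsSignInvariantNorm.measurable_clippedCost (hN : IsSignInvariantNorm N)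
    (g : Fin k → Fin d → ℝ) : Measurable (clippedCost N p g) := by
  have h : ∀ j, Measurable fun x => N (x - g j) := fun j =>
    (hN.continuous.comp (continuous_id.sub continuous_const)).measurable
  exact (measurable_const.min (Measurable.iInf h)).pow_const p

lemma abs_clippedCost_sub_le (hk : 1 ≤ k) (hp : 1 ≤ p) {g g' : Fin k → Fin d → ℝ} {η : ℝ}
    (h : ∀ j, N (g j - g' j) ≤ η) (x : Fin d → ℝ) :
    |clippedCost N p g x - clippedCost N p g' x| ≤ p * η := by
  have : Nonempty (Fin k) := ⟨⟨0, hk⟩⟩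
  refine (abs_rpow_sub_rpow_le hp (clipped_mem_Icc N g x) (clipped_mem_Icc N g' x)).trans ?_
  refine mul_le_mul_of_nonneg_left ?_ (by linarith)
  refine (abs_min_sub_min_le_max _ _ _ _).trans ?_
  simp only [sub_self, abs_zero]
  -- The constant `1` contributes `0 ≤ η`, read off from any one center since `k ≥ 1`.
  refine max_le ((apply_nonneg N _).trans (h ⟨0, hk⟩)) (abs_ciInf_sub_ciInf_le fun j => ?_)
  refine (abs_sub_map_le_sub N _ _).trans ?_
  rw [sub_sub_sub_cancel_left, map_sub_rev]
  exact h j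

/-- Clipping is inactive here because the ball has diameter at most `1`. -/
lemma exists_tuple_kappaSet_rpow_eq (hk : 1 ≤ k) {F : Finset (Fin d → ℝ)}
    (hF : F ∈ centerSets N k) :
    ∃ g : Fin k → Fin d → ℝ, (∀ j, g j ∈ ball N) ∧
      ∀ x ∈ ball N, kappaSet N x F ^ p = clippedCost N p g x := by
  obtain ⟨hFb, hFk⟩ := hF
  let e : Fin k ≃ {f // f ∈ F} := (F.equivFinOfCardEq hFk).symm
  have hg : ∀ j, (e j : Fin d → ℝ) ∈ ball N := fun j => hFb (e j).2
  refine ⟨fun j => e j, hg, fun x hx => ?_⟩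
  have h1 : kappaSet N x F = ⨅ j, N (x - e j) :=
    (e.iInf_comp (g := fun f : {f // f ∈ F} => kappa N x f)).symm
  rw [h1, clippedCost, min_eq_right]
  exact (ciInf_le (Set.finite_range _).bddBelow (⟨0, hk⟩ : Fin k)).trans
    (sub_le_one_of_mem_ball hx (hg _))

end ClippedCost

/-- Two-sided Hoeffding inequality for an empirical mean of a `[0, 1]`-valued function. -/
lemma measureReal_le_abs_empirical_mean_sub_le {Ω E : Type*} [MeasurableSpace Ω]
    [MeasurableSpace E] {μ : Measure Ω} [IsProbabilityMeasure μ] {P : Measure E} {n : ℕ}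
    (hn : 0 < n) {X : Fin n → Ω → E} (hX : iIndepFun X μ) (hlaw : ∀ i, HasLaw (X i) P μ)
    {f : E → ℝ} (hf : Measurable f) (hf01 : ∀ x, f x ∈ Set.Icc (0 : ℝ) 1) {η : ℝ} (hη : 0 ≤ η) :
    μ.real {ω | η ≤ |(1 / (n : ℝ)) * ∑ i, f (X i ω) - ∫ x, f x ∂P|}
      ≤ 2 * Real.exp (-(2 * n * η ^ 2)) := by
  have hn' : (0 : ℝ) < n := Nat.cast_pos.2 hn
  set c := ∫ x, f x ∂P with hc
  have hmean : ∀ i, μ[fun ω => f (X i ω)] = c := fun i =>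
    (hlaw i).integral_comp hf.aestronglyMeasurable
  have hsub : ∀ i, HasSubgaussianMGF (fun ω => f (X i ω) - c) ((‖(1 : ℝ) - 0‖₊ / 2) ^ 2) μ := by
    intro i
    have := hasSubgaussianMGF_of_mem_Icc (μ := μ) (X := fun ω => f (X i ω)) (a := 0) (b := 1)
      (hf.comp_aemeasurable (hlaw i).aemeasurable) (ae_of_all _ fun ω => hf01 _)
    rwa [hmean i] at this
  have hind : iIndepFun (fun i ω => f (X i ω) - c) μ :=
    hX.comp (fun _ x => f x - c) fun _ => hf.sub_const c
  have hind' : iIndepFun (fun i ω => -(f (X i ω) - c)) μ :=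
    hX.comp (fun _ x => -(f x - c)) fun _ => (hf.sub_const c).neg
  -- Each summand has variance proxy `1/4`, so the total is `n/4`.
  have hexp : Real.exp (-(n * η) ^ 2 /
      (2 * ∑ _i : Fin n, (((‖(1 : ℝ) - 0‖₊ / 2) ^ 2 : NNReal) : ℝ)))
      = Real.exp (-(2 * n * η ^ 2)) := by
    congr 1
    simp
    field_simp
  have h1 := HasSubgaussianMGF.measure_sum_ge_le_of_iIndepFun hind (s := Finset.univ)
    (fun i _ => hsub i) (mul_nonneg hn'.le hη)
  have h2 := HasSubgaussianMGF.measure_sum_ge_le_of_iIndepFun hind' (s := Finset.univ)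
    (fun i _ => (hsub i).neg) (mul_nonneg hn'.le hη)
  rw [NNReal.coe_sum, hexp] at h1 h2
  refine (measureReal_mono (fun ω hω => ?_)).trans ((measureReal_union_le _ _).trans
    ((add_le_add h1 h2).trans_eq (two_mul _).symm))
  have hs : ∑ i, (f (X i ω) - c) = n * ((1 / (n : ℝ)) * ∑ i, f (X i ω) - c) := by
    rw [Finset.sum_sub_distrib]
    simp
    field_simp
  rcases le_abs.1 (show η ≤ _ from hω) with h | h
  · left
    simp only [Set.mem_ofPred_eq, hs]
    gcongr
  · right
    simp only [Set.mem_ofPred_eq, Finset.sum_neg_distrib, hs, ← mul_neg]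
    gcongr

/-- The Hoeffding bounds for all grid tuples add up to at most `δ`. -/
lemma card_mul_hoeffding_le {d k n m : ℕ} (hd : 1 ≤ d) (hk : 1 ≤ k) {p ε δ : ℝ} (hp : 1 ≤ p)
    (hε0 : 0 < ε) (hε1 : ε < 1) (hδ0 : 0 < δ) (hδ1 : δ < 1)
    (hn : 16 * ((k : ℝ) ^ 2 * (d : ℝ) ^ 2 / ε ^ 4 * max 1 (Real.log (p / δ))) ≤ (n : ℝ))
    (hm : (m : ℝ) + 1 ≤ 6 * p * d / ε) :
    (((m : ℝ) + 1) ^ d) ^ k * (2 * Real.exp (-(2 * n * (ε / 2) ^ 2))) ≤ δ := by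
  have hd' : (1 : ℝ) ≤ d := by exact_mod_cast hd
  have hk' : (1 : ℝ) ≤ k := by exact_mod_cast hk
  have hm0 : (0 : ℝ) < m + 1 := by positivity
  have hp0 : 0 < p := by linarith
  set M := max 1 (Real.log (p / δ)) with hM
  have hM1 : 1 ≤ M := le_max_left _ _
  have hlogp : 0 ≤ Real.log p := Real.log_nonneg hp
  have hlogδ : Real.log δ ≤ 0 := Real.log_nonpos hδ0.le hδ1.le
  have hMlog : Real.log p - Real.log δ ≤ M := by
    rw [← Real.log_div hp0.ne' hδ0.ne']; exact le_max_right _ _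
  set K : ℝ := k * d with hK
  have hK1 : 1 ≤ K := one_le_mul_of_one_le_of_one_le hk' hd'
  -- `A` is the common unit: the exponent is at least `8 * A`, while the grid count, `log 2` and
  -- `-log δ` use at most `5 * A`, `A` and `A`.
  set A := K ^ 2 * M / ε ^ 2 with hA
  have hε2 : 0 < ε ^ 2 := by positivity
  have hinv : 1 / ε ≤ 1 / ε ^ 2 :=
    one_div_le_one_div_of_le hε2 (by nlinarith)
  have hinv1 : 1 ≤ 1 / ε ^ 2 := by
    rw [le_div_iff₀ hε2]; nlinarith
  have hKK : K ≤ K ^ 2 := by nlinarith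
  have hKM : K ^ 2 * M ≤ A := by
    have : 0 ≤ K ^ 2 * M := by positivity
    calc K ^ 2 * M ≤ K ^ 2 * M * (1 / ε ^ 2) := le_mul_of_one_le_right this hinv1
      _ = A := by rw [hA]; ring
  have hK2 : K ^ 2 ≤ A := (le_mul_of_one_le_right (by positivity) hM1).trans hKM
  have hMA : M ≤ A := (le_mul_of_one_le_left (by linarith) (by nlinarith)).trans hKM
  have hexp : 8 * A ≤ 2 * n * (ε / 2) ^ 2 := by
    have : 8 * A = 2 * (16 * ((k : ℝ) ^ 2 * (d : ℝ) ^ 2 / ε ^ 4 * M)) * (ε / 2) ^ 2 := by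
      rw [hA, hK]; field_simp; ring
    rw [this]
    gcongr
  have h6 : Real.log 6 ≤ 2 := by
    rw [Real.log_le_iff_le_exp (by norm_num)]
    have := Real.exp_one_gt_d9
    have h2 : Real.exp 2 = Real.exp 1 * Real.exp 1 := by rw [← Real.exp_add]; norm_num
    rw [h2]; nlinarith
  have hl2 : Real.log 2 ≤ 1 := by linarith [Real.log_two_lt_d9]
  have hlm : Real.log (m + 1) ≤ Real.log 6 + Real.log p + Real.log d - Real.log ε := by
    refine (Real.log_le_log hm0 hm).trans_eq ?_
    rw [Real.log_div (by positivity) hε0.ne', Real.log_mul (by positivity) (by positivity),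
      Real.log_mul (by norm_num) hp0.ne']
  have hld : Real.log d ≤ K := by
    have := Real.log_le_sub_one_of_pos (show (0 : ℝ) < d by linarith)
    exact (this.trans (by linarith)).trans (le_mul_of_one_le_left (by linarith) hk')
  have hle : -Real.log ε ≤ 1 / ε ^ 2 := by
    have := Real.log_le_sub_one_of_pos (show (0 : ℝ) < 1 / ε by positivity)
    rw [one_div, Real.log_inv, ← one_div] at this
    linarith
  have hK0 : 0 ≤ K := zero_le_one.trans hK1
  have t1 : K * Real.log 6 ≤ 2 * A := by
    linarith [mul_le_mul_of_nonneg_left h6 hK0]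
  have t2 : K * Real.log p ≤ A :=
    le_trans (mul_le_mul hKK (by linarith) hlogp (by positivity)) hKM
  have t3 : K * Real.log d ≤ A := by
    linarith [mul_le_mul_of_nonneg_left hld hK0, sq K]
  have t4 : K * (-Real.log ε) ≤ A := by
    calc K * (-Real.log ε) ≤ (K ^ 2 * M) * (1 / ε ^ 2) := by
          refine mul_le_mul (hKK.trans (le_mul_of_one_le_right (by positivity) hM1)) hle ?_ (by positivity)
          linarith [Real.log_nonpos hε0.le hε1.le]
      _ = A := by rw [hA]; ring
  have t5 : K * Real.log (m + 1) ≤ 5 * A := by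
    linarith [mul_le_mul_of_nonneg_left hlm hK0]
  have hpow : (((m : ℝ) + 1) ^ d) ^ k = Real.exp (K * Real.log (m + 1)) := by
    rw [← pow_mul, ← Real.exp_log (pow_pos hm0 (d * k)), Real.log_pow, hK]
    push_cast
    ring_nf
  calc (((m : ℝ) + 1) ^ d) ^ k * (2 * Real.exp (-(2 * n * (ε / 2) ^ 2)))
      = Real.exp (K * Real.log (m + 1) + Real.log 2 + -(2 * n * (ε / 2) ^ 2)) := by
        rw [hpow, Real.exp_add, Real.exp_add, Real.exp_log (by norm_num : (0 : ℝ) < 2)]; ring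
    _ ≤ Real.exp (Real.log δ) := Real.exp_le_exp.2 (by linarith)
    _ = δ := Real.exp_log hδ0

/-! ### From the grid to arbitrary centers -/

section Approximation

variable {d k n : ℕ} {N : Seminorm ℝ (Fin d → ℝ)} {p : ℝ}

lemma abs_empiricalCost_sub_le (hn : 0 < n) {x : Fin n → Fin d → ℝ} {F : Finset (Fin d → ℝ)}
    {f : (Fin d → ℝ) → ℝ} {η : ℝ} (h : ∀ i, |kappaSet N (x i) F ^ p - f (x i)| ≤ η) :
    |empiricalCost N p x F - (1 / (n : ℝ)) * ∑ i, f (x i)| ≤ η := by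
  have hn' : (0 : ℝ) < n := Nat.cast_pos.2 hn
  rw [empiricalCost, ← mul_sub, ← Finset.sum_sub_distrib, abs_mul,
    abs_of_nonneg (by positivity : 0 ≤ 1 / (n : ℝ))]
  calc 1 / (n : ℝ) * |∑ i, (kappaSet N (x i) F ^ p - f (x i))|
      ≤ 1 / (n : ℝ) * ∑ _i : Fin n, η := by
        gcongr
        exact (Finset.abs_sum_le_sum_abs _ _).trans (Finset.sum_le_sum fun i _ => h i)
    _ = η := by simp; field_simp

lemma abs_integral_sub_integral_le {E : Type*} [MeasurableSpace E] {P : Measure E}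
    [IsProbabilityMeasure P] {f g : E → ℝ} (hf : Integrable f P) (hg : Integrable g P) {η : ℝ}
    (h : ∀ x, |f x - g x| ≤ η) : |∫ x, f x ∂P - ∫ x, g x ∂P| ≤ η := by
  rw [← integral_sub hf hg]
  simpa using norm_integral_le_of_norm_le_const (μ := P) (f := fun x => f x - g x) (ae_of_all _ h)

/-- If the empirical means of all clipped grid costs are accurate, so are all empirical costs. -/
lemma abs_empiricalCost_sub_cost_le {m : ℕ} (hk : 1 ≤ k) (hn : 0 < n) (hm : 0 < m) (hp : 1 ≤ p)
    (hN : IsSignInvariantNorm N) {P : Measure (Fin d → ℝ)} [IsProbabilityMeasure P]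
    (hP : ∀ᵐ x ∂P, x ∈ ball N) {ε : ℝ} (hmε : p * (d / m) ≤ ε / 4) {x : Fin n → Fin d → ℝ}
    (hx : ∀ i, x i ∈ ball N)
    (h : ∀ t : Fin k → Fin d → Fin (m + 1),
      |(1 / (n : ℝ)) * ∑ i, clippedCost N p (fun j => gridPoint (t j)) (x i)
        - ∫ y, clippedCost N p (fun j => gridPoint (t j)) y ∂P| < ε / 2)
    {F : Finset (Fin d → ℝ)} (hF : F ∈ centerSets N k) :
    |empiricalCost N p x F - cost N p P F| ≤ ε := by
  obtain ⟨g, hg, hgF⟩ := exists_tuple_kappaSet_rpow_eq (p := p) hk hF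
  choose t ht using fun j => hN.exists_gridPoint hm (hg j)
  have hclose := fun y => (abs_clippedCost_sub_le hk hp ht y).trans hmε
  have hint : ∀ g : Fin k → Fin d → ℝ, Integrable (clippedCost N p g) P := fun g =>
    Integrable.of_mem_Icc 0 1 (hN.measurable_clippedCost g).aemeasurable
      (ae_of_all _ fun y => clippedCost_mem_Icc hp g y)
  have h1 := abs_empiricalCost_sub_le (p := p) hn (F := F) fun i =>
    (congrArg (fun z => |z - _|) (hgF (x i) (hx i))).trans_le (hclose (x i))
  have h2 : cost N p P F = ∫ y, clippedCost N p g y ∂P :=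
    integral_congr_ae (hP.mono fun y hy => hgF y hy)
  have h3 := abs_integral_sub_integral_le (hint _) (hint _) hclose
  rw [h2]
  have h4 := h t
  rw [abs_le] at h1 h3 ⊢
  rw [abs_lt] at h4
  constructor <;> linarith [h1.1, h1.2, h3.1, h3.2, h4.1, h4.2]

end Approximation

end Clustering

theorem mainTheorem5 :
    ∃ C : ℝ, 0 < C ∧
      ∀ (d k : ℕ) (_ : 1 ≤ d) (_ : 1 ≤ k) (p : ℝ) (_ : 1 ≤ p)
        (N : Seminorm ℝ (Fin d → ℝ)) (_ : Clustering.IsSignInvariantNorm N)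
        (P : Measure (Fin d → ℝ)) (_ : IsProbabilityMeasure P)
        (_ : ∀ᵐ x ∂P, x ∈ Clustering.ball N)
        (ε δ : ℝ) (_ : 0 < ε) (_ : ε < 1) (_ : 0 < δ) (_ : δ < 1)
        (n : ℕ)
        (_ : C * ((k : ℝ) ^ 2 * (d : ℝ) ^ 2 / ε ^ 4 * max 1 (Real.log (p / δ))) ≤ (n : ℝ))
        {Ω : Type*} [MeasurableSpace Ω] (μ : Measure Ω) [IsProbabilityMeasure μ]
        (X : Fin n → Ω → (Fin d → ℝ)) (_ : iIndepFun X μ) (_ : ∀ i, HasLaw (X i) P μ),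
        ENNReal.ofReal (1 - δ) ≤
          μ {ω | ∀ F ∈ Clustering.centerSets N k,
            |Clustering.empiricalCost N p (fun i => X i ω) F - Clustering.cost N p P F| ≤ ε} := by
  refine ⟨16, by norm_num, ?_⟩
  intro d k hd hk p hp N hN P _ hP ε δ hε0 hε1 hδ0 hδ1 n hn Ω _ μ _ X hX hlaw
  have hd' : (1 : ℝ) ≤ d := by exact_mod_cast hd
  have hk' : (1 : ℝ) ≤ k := by exact_mod_cast hk
  have hn0 : 0 < n := by
    have h1 : (1 : ℝ) ≤ max 1 (Real.log (p / δ)) := le_max_left _ _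
    have : (0 : ℝ) < n := lt_of_lt_of_le (by positivity) hn
    exact_mod_cast this
  -- The factor `4` gives `p * (d / m) ≤ ε / 4`. Since `p * d / ε ≥ 1`, the ceiling and the extra
  -- endpoint fit in `6 * p * d / ε`.
  set m := ⌈4 * p * d / ε⌉₊ with hm
  have hpd : 1 ≤ p * d := one_le_mul_of_one_le_of_one_le hp hd'
  have hq : 1 ≤ p * d / ε := by rw [le_div_iff₀ hε0]; linarith
  have hqm : 4 * p * d / ε ≤ m := Nat.le_ceil _
  have hm0 : 0 < m := Nat.ceil_pos.2 (by positivity)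
  have hm0' : (0 : ℝ) < m := Nat.cast_pos.2 hm0
  have hmle : (m : ℝ) + 1 ≤ 6 * p * d / ε := by
    have h1 := (Nat.ceil_lt_add_one (show 0 ≤ 4 * p * d / ε by positivity)).le
    have h2 : 4 * p * d / ε = 4 * (p * d / ε) := by ring
    have h3 : 6 * p * d / ε = 6 * (p * d / ε) := by ring
    rw [← hm] at h1
    linarith
  have hmε : p * (d / m) ≤ ε / 4 := by
    rw [div_le_iff₀ hε0] at hqm
    rw [← mul_div_assoc, div_le_iff₀ hm0']
    linarith
  let f (t : Fin k → Fin d → Fin (m + 1)) : (Fin d → ℝ) → ℝ :=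
    Clustering.clippedCost N p fun j => Clustering.gridPoint (t j)
  let bad (t : Fin k → Fin d → Fin (m + 1)) : Set Ω :=
    {ω | ε / 2 ≤ |(1 / (n : ℝ)) * ∑ i, f t (X i ω) - ∫ x, f t x ∂P|}
  have hbad : μ.real (⋃ t, bad t) ≤ δ := by
    refine (measureReal_iUnion_fintype_le bad).trans ((Finset.sum_le_sum fun t _ =>
      Clustering.measureReal_le_abs_empirical_mean_sub_le hn0 hX hlaw
        (hN.measurable_clippedCost _) (fun x => Clustering.clippedCost_mem_Icc hp _ x)
        (half_pos hε0).le).trans ?_)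
    refine le_trans (le_of_eq ?_)
      (Clustering.card_mul_hoeffding_le hd hk hp hε0 hε1 hδ0 hδ1 hn hmle)
    simp
  have hgood : 1 - δ ≤ μ.real (⋃ t, bad t)ᶜ := by
    have h := measureReal_union_le (μ := μ) (⋃ t, bad t) (⋃ t, bad t)ᶜ
    rw [Set.union_compl_self, probReal_univ] at h
    linarith
  have hball : ∀ᵐ ω ∂μ, ∀ i, X i ω ∈ Clustering.ball N := by
    refine ae_all_iff.2 fun i => ?_
    have : ∀ᵐ x ∂(μ.map (X i)), x ∈ Clustering.ball N := by rw [(hlaw i).map_eq]; exact hP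
    exact ae_of_ae_map (hlaw i).aemeasurable this
  calc ENNReal.ofReal (1 - δ) ≤ μ (⋃ t, bad t)ᶜ :=
        ENNReal.ofReal_le_of_le_toReal hgood
    _ ≤ _ := by
        -- Samples lie in the ball only almost surely, so the inclusion of events holds up to a null
        -- set.
        refine measure_mono_ae (hball.mono fun ω hω hgoodω F hF => ?_)
        refine Clustering.abs_empiricalCost_sub_cost_le hk hn0 hm0 hp hN hP hmε hω
          (fun t => ?_) hF
        by_contra hlt
        exact hgoodω (Set.mem_iUnion.2 ⟨t, not_lt.1 hlt⟩)
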